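/- **Theorem (Fisher's inequality for designs in polar spaces).** Let $\mathcal{Q}$ be a finite classical polar space over $\mathbb{F}_q$, i.e. the set of all totally isotropic (respectively totally singular) subspaces of a finite-dimensional $\mathbb{F}_q$-vector space $V$ with respect to a nondegenerate alternating bilinear form, a nondegenerate Hermitian form (for a field involution $\sigma\neq\mathrm{id}$ of $\mathbb{F}_q$), or a nonsingular quadratic form (one for which no nonzero singular vector lies in the radical of the polar form). Let $r$ be the rank of $\mathcal{Q}$, i.e. the largest vector space dimension of a member of $\mathcal{Q}$. Points of $\mathcal{Q}$ are the members of dimension $1$. Let $t,k\in\{0,\dots,r\}$ with $t\ge 2$, let $\lambda\ge 1$ be an integer, and let $D$ be a $t$-$(r,k,\lambda)_Q$ design in $\mathcal{Q}$: a set $D$ of $k$-dimensional members of $\mathcal{Q}$ (the blocks) such that every $t$-dimensional member of $\mathcal{Q}$ is contained in exactly $\lambda$ elements of $D$. Let $\lambda_0=\#D$ be the number of blocks. 1. If $k<r$, then $\lambda_0$ is at least the number of points of $\mathcal{Q}$. 2. If $k=r$, then $\lambda_0\ge 1+m_1$, where $m_1$ is the multiplicity of the eigenvalue $q^{r-1}-1$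 of the (real) adjacency matrix of the collinearity graph of $\mathcal{Q}$ (in particular, $q^{r-1}-1$ is an eigenvalue). The vertices of this graph are the points of $\mathcal{Q}$, and two distinct points are adjacent if the line they span belongs to $\mathcal{Q}$. -/

import Mathlib

noncomputable section

/-- A finite classical polar space embedded in `V`, given by its defining form: a nondegenerate
alternating bilinear form, a nondegenerate Hermitian form with respect to a field involution
`σ ≠ id`, or a nonsingular quadratic form.  (A quadratic form is nonsingular if no nonzero singular
vector lies in the radical of the polar form; in even characteristic this includes the parabolic
case, where the radical of the polar form is one-dimensional.) -/
inductive ClassicalPolarSpace (F V : Type*) [Field F] [AddCommGroup V] [Module F V] where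
  | symplectic (B : V →ₗ[F] V →ₗ[F] F) (alt : B.IsAlt) (nondeg : B.Nondegenerate)
  | hermitian (σ : F →+* F) (invol : ∀ a, σ (σ a) = a) (ne_id : σ ≠ RingHom.id F)
      (B : V →ₛₗ[σ] V →ₗ[F] F) (herm : B.IsSymm) (nondeg : B.Nondegenerate)
  | orthogonal (f : QuadraticForm F V)
      (nonsing : ∀ x, f x = 0 → (∀ y, QuadraticMap.polar f x y = 0) → x = 0)

namespace ClassicalPolarSpace

variable {F V : Type*} [Field F] [AddCommGroup V] [Module F V]

/-- `𝒬.Mem U`: the subspace `U` of `V` belongs to the polar space, i.e. it is totally isotropic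
(symplectic and Hermitian case) resp. totally singular (orthogonal case). -/
def Mem : ClassicalPolarSpace F V → Submodule F V → Prop
  | symplectic B _ _, U => ∀ x ∈ U, ∀ y ∈ U, B x y = 0
  | hermitian _ _ _ B _ _, U => ∀ x ∈ U, ∀ y ∈ U, B x y = 0
  | orthogonal f _, U => ∀ x ∈ U, f x = 0

/-- The rank: the largest (algebraic) dimension of a subspace belonging to the polar space. -/
def rank (𝒬 : ClassicalPolarSpace F V) : ℕ :=
  sSup {d | ∃ U : Submodule F V, 𝒬.Mem U ∧ Module.finrank F U = d}

/-- The set of subspaces of (algebraic) dimension `k` of the polar space. -/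
def subspaces (𝒬 : ClassicalPolarSpace F V) (k : ℕ) : Set (Submodule F V) :=
  {U | 𝒬.Mem U ∧ Module.finrank F U = k}

/-- The points of the polar space. -/
abbrev Point (𝒬 : ClassicalPolarSpace F V) : Type _ := 𝒬.subspaces 1

/-- The collinearity graph: two distinct points are adjacent if the line they span belongs to the
polar space. -/
def collinearityGraph (𝒬 : ClassicalPolarSpace F V) : SimpleGraph 𝒬.Point where
  Adj P P' := P ≠ P' ∧ 𝒬.Mem (P.1 ⊔ P'.1)
  symm := ⟨fun P P' h => ⟨h.1.symm, by rw [sup_comm]; exact h.2⟩⟩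
  loopless := ⟨fun _ h => h.1 rfl⟩

instance instFinitePoint [Finite F] [FiniteDimensional F V] (𝒬 : ClassicalPolarSpace F V) :
    Finite 𝒬.Point :=
  have : Finite V := Module.finite_of_finite F
  inferInstance

instance instFintypePoint [Finite F] [FiniteDimensional F V] (𝒬 : ClassicalPolarSpace F V) :
    Fintype 𝒬.Point := Fintype.ofFinite _

open Classical in
/-- The real adjacency matrix of the collinearity graph, as an endomorphism of the space of real
functions on the points. -/
def adjacency [Finite F] [FiniteDimensional F V] (𝒬 : ClassicalPolarSpace F V) :
    Module.End ℝ (𝒬.Point → ℝ) :=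
  Matrix.toLin' (𝒬.collinearityGraph.adjMatrix ℝ)

/-- `D` is a `t`-`(r, k, lam)` design in the polar space `𝒬`, where `r` is the rank of `𝒬`. -/
structure IsDesign (𝒬 : ClassicalPolarSpace F V) (t r k lam : ℕ) (D : Set (Submodule F V)) :
    Prop where
  rank_eq : 𝒬.rank = r
  t_le : t ≤ r
  k_le : k ≤ r
  subset : D ⊆ 𝒬.subspaces k
  ncard_eq : ∀ T ∈ 𝒬.subspaces t, {B ∈ D | T ≤ B}.ncard = lam

end ClassicalPolarSpace

end

/-! Let `N` be the point-block incidence matrix. If every point lies in `l₁` blocks and every line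
in `l₂`, then `N Nᵀ = l₁ I + l₂ A`, with `A` the collinearity matrix, since noncollinear points
share no block (`sum_blockSum_eq`). Both bounds come from injectivity of `Nᵀ` (`blockSum`) on a
suitable space of functions.

For `k < r`, let `Nᵀ x = 0`, so that `l₁ |x|² + l₂ xᵀAx = 0`. All generators form a design too, with
parameters `g₁`, `g₂`, so `g₁ |x|² + g₂ xᵀAx ≥ 0`. Counting gives `l₁ / l₂ = (s - q) / (q^k - q)`,
where `s` is the number of singular vectors perpendicular to a point. This ratio strictly decreases
in `k`, hence `l₁ / l₂ > g₁ / g₂` and `x = 0`. The spectrum of `A` is not needed.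

For `k = r`, `N Nᵀ` acts by positive scalars on the constants and on the eigenspace of `q^(r-1) -
1`, so `Nᵀ` is injective on their sum. The eigenvalue itself comes from the indicator function of a
generator.

That a `t`-design is a 1- and a 2-design needs the number of singular vectors in `U⊥` to depend only
on `dim U`. Instead of Witt's theorem, this uses that all relevant affine lines carry the same
number `lineCount` of singular vectors. -/

noncomputable section

/-- Uniform description of a nondegenerate alternating, Hermitian or quadratic form: a reflexive
sesquilinear form together with its set of isotropic (resp. singular) vectors. -/
structure PolarModel (F V : Type*) [Field F] [AddCommGroup V] [Module F V] where
  /-- the field automorphism of the sesquilinear form -/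
  σ : F →+* F
  invol : ∀ a, σ (σ a) = a
  /-- the sesquilinear form -/
  form : V →ₛₗ[σ] V →ₗ[F] F
  refl : form.IsRefl
  /-- the isotropic (resp. singular) vectors -/
  singular : Set V
  smul_mem : ∀ (a : F), ∀ x ∈ singular, a • x ∈ singular
  add_mem : ∀ x ∈ singular, ∀ y ∈ singular, form x y = 0 → x + y ∈ singular
  form_self : ∀ x ∈ singular, form x x = 0
  nondeg : ∀ x ∈ singular, (∀ y, form x y = 0) → x = 0
  /-- the number of singular vectors in an affine line whose direction is a singular vector
  not perpendicular to the line -/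
  lineCount : ℕ
  lineCount_pos : 0 < lineCount
  card_line : ∀ x ∈ singular, ∀ v, form x v ≠ 0 →
    Nat.card {a : F // v + a • x ∈ singular} = lineCount

/-! ### Totally singular subspaces and their perps. -/

namespace PolarModel

variable {F V : Type*} [Field F] [AddCommGroup V] [Module F V]

/-- The totally isotropic (resp. singular) subspaces. -/
def Mem (M : PolarModel F V) (U : Submodule F V) : Prop :=
  ∀ x ∈ U, x ∈ M.singular ∧ ∀ y ∈ U, M.form x y = 0

theorem Mem.mono {M : PolarModel F V} {U W : Submodule F V} (hU : M.Mem U) (h : W ≤ U) :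
    M.Mem W := fun x hx => ⟨(hU x (h hx)).1, fun y hy => (hU x (h hx)).2 y (h hy)⟩

/-- The subspace of vectors perpendicular to all vectors of `U`. -/
def perp (M : PolarModel F V) (U : Submodule F V) : Submodule F V where
  carrier := {v | ∀ u ∈ U, M.form u v = 0}
  add_mem' {a b} ha hb u hu := by rw [map_add, ha u hu, hb u hu, add_zero]
  zero_mem' u _ := map_zero _
  smul_mem' c a ha u hu := by rw [map_smul, ha u hu, smul_zero]

theorem mem_perp {M : PolarModel F V} {U : Submodule F V} {v : V} :
    v ∈ M.perp U ↔ ∀ u ∈ U, M.form u v = 0 := Iff.rfl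

theorem perp_anti (M : PolarModel F V) {U W : Submodule F V} (h : W ≤ U) :
    M.perp U ≤ M.perp W := fun _ hv u hu => hv u (h hu)

theorem Mem.le_perp {M : PolarModel F V} {U : Submodule F V} (hU : M.Mem U) : U ≤ M.perp U :=
  fun v hv u hu => (hU u hu).2 v hv

theorem Mem.span_singleton {M : PolarModel F V} {x : V} (hx : x ∈ M.singular) :
    M.Mem (F ∙ x) := by
  intro y hy
  obtain ⟨a, rfl⟩ := Submodule.mem_span_singleton.1 hy
  refine ⟨M.smul_mem a x hx, fun z hz => ?_⟩
  obtain ⟨b, rfl⟩ := Submodule.mem_span_singleton.1 hz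
  simp [M.form_self x hx]

theorem Mem.sup {M : PolarModel F V} {U W : Submodule F V} (hU : M.Mem U) (hW : M.Mem W)
    (h : W ≤ M.perp U) : M.Mem (U ⊔ W) := by
  intro x hx
  obtain ⟨u, hu, w, hw, rfl⟩ := Submodule.mem_sup.1 hx
  refine ⟨M.add_mem u (hU u hu).1 w (hW w hw).1 (h hw u hu), fun y hy => ?_⟩
  obtain ⟨u', hu', w', hw', rfl⟩ := Submodule.mem_sup.1 hy
  simp [(hU u hu).2 u' hu', (hW w hw).2 w' hw', h hw' u hu, M.refl _ _ (h hw u' hu')]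

/-- A vector of `U` in the radical of the form is singular, hence zero. So the form embeds `U` into
the dual space even if the radical is nonzero, and `M.perp U` is the coannihilator of the image. -/
theorem finrank_perp [Finite F] [FiniteDimensional F V] (M : PolarModel F V) {U : Submodule F V}
    (hU : M.Mem U) :
    Module.finrank F (M.perp U) + Module.finrank F U = Module.finrank F V := by
  have : RingHomSurjective M.σ := ⟨fun a => ⟨M.σ a, M.invol a⟩⟩
  have hco : (U.map M.form).dualCoannihilator = M.perp U := by
    ext v
    simp [Submodule.mem_dualCoannihilator, mem_perp]
  have hinj : Set.InjOn M.form U := by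
    intro x hx y hy hxy
    refine sub_eq_zero.1 (M.nondeg _ (hU _ (U.sub_mem hx hy)).1 fun z => ?_)
    rw [map_sub, hxy, sub_self, LinearMap.zero_apply]
  -- The embedding is only `σ`-semilinear, so dimensions are compared through cardinalities.
  have hcard : Nat.card (U.map M.form) = Nat.card U := by
    rw [← SetLike.coe_sort_coe, Submodule.map_coe]
    exact Nat.card_image_of_injOn hinj
  rw [Module.natCard_eq_pow_finrank (K := F) (V := U),
    Module.natCard_eq_pow_finrank (K := F) (V := U.map M.form)] at hcard
  have hrank := Nat.pow_right_injective (Finite.one_lt_card (α := F)) hcard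
  have h := Subspace.finrank_add_finrank_dualCoannihilator_eq (U.map M.form)
  rw [hco, hrank] at h
  omega

end PolarModel

/-! ### The three types of forms as instances of one model. -/

namespace ClassicalPolarSpace

variable {F V : Type*} [Field F] [AddCommGroup V] [Module F V]

/-- For an involution `σ ≠ id` every `σ`-fixed element is a trace `a + σ a`. -/
theorem exists_add_involution_eq (σ : F →+* F) (invol : ∀ a, σ (σ a) = a)
    (ne_id : σ ≠ RingHom.id F) {c : F} (hc : σ c = c) : ∃ a, a + σ a = c := by
  obtain ⟨b, hb⟩ : ∃ b, b + σ b ≠ 0 := by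
    by_contra! h
    refine ne_id (RingHom.ext fun a => ?_)
    have h1 : (1 : F) + 1 = 0 := by simpa using h 1
    have h2 : σ a = -a := eq_neg_of_add_eq_zero_right (h a)
    rw [h2, RingHom.id_apply, neg_eq_iff_add_eq_zero, ← two_mul, ← one_add_one_eq_two, h1, zero_mul]
  refine ⟨b * (c / (b + σ b)), ?_⟩
  simp only [map_mul, map_div₀, map_add, invol, hc]
  rw [add_comm (σ b) b]
  field_simp

theorem exists_model [Finite F] (𝒬 : ClassicalPolarSpace F V) :
    ∃ M : PolarModel F V, ∀ U, 𝒬.Mem U ↔ M.Mem U := by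
  cases 𝒬 with
  | symplectic B alt nondeg =>
    exact ⟨{ σ := RingHom.id F, invol := fun _ => rfl, form := B, refl := alt.isRefl
             singular := Set.univ, smul_mem := fun _ _ _ => trivial
             add_mem := fun _ _ _ _ _ => trivial, form_self := fun x _ => alt x
             nondeg := fun x _ h => nondeg.1 x h
             lineCount := Nat.card F, lineCount_pos := Nat.card_pos
             card_line := fun x _ v _ => Nat.card_congr (Equiv.subtypeUnivEquiv fun _ => trivial) },
      fun U => by simp [Mem, PolarModel.Mem]⟩
  | hermitian σ invol ne_id B herm nondeg =>
    refine ⟨{ σ := σ, invol := invol, form := B, refl := herm.isRefl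
              singular := {x | B x x = 0}
              smul_mem := fun a x hx => by simp_all
              add_mem := fun x hx y hy h => by simp_all [herm.isRefl x y h]
              form_self := fun x hx => hx
              nondeg := fun x _ h => nondeg.1 x h
              lineCount := Nat.card {a : F // a + σ a = 0}
              lineCount_pos := by
                have : Nonempty {a : F // a + σ a = 0} := ⟨⟨0, by simp⟩⟩
                exact Nat.card_pos
              card_line := fun x hx v hv => ?_ },
      fun U => ⟨fun h x hx => ⟨h x hx x hx, h x hx⟩, fun h x hx => (h x hx).2⟩⟩
    have hv' : B v x ≠ 0 := fun h => hv (herm.isRefl _ _ h)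
    have key : ∀ a, B (v + a • x) (v + a • x) = B v v + (a * B v x + σ (a * B v x)) := by
      intro a
      have hx' : B x x = 0 := hx
      simp [herm.eq, hx']
      ring
    -- With `B v v` written as the trace of `b`, singularity of `v + a • x` says that `a * B v x +
    -- b` has trace zero; this is an affine substitution in `a`.
    obtain ⟨b, hb⟩ := exists_add_involution_eq σ invol ne_id (c := B v v) (herm.eq v v)
    refine Nat.card_congr (Equiv.subtypeEquiv
      ((Equiv.mulRight₀ (B v x) hv').trans (Equiv.addRight b)) fun a => ?_)
    change B (v + a • x) (v + a • x) = 0 ↔ (a * B v x + b) + σ (a * B v x + b) = 0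
    rw [key, map_add, ← hb]
    constructor <;> intro h <;> linear_combination h
  | orthogonal f nonsing =>
    have key : ∀ x y, f (x + y) = f x + f y + QuadraticMap.polar f x y := fun x y => by
      simp [QuadraticMap.polar]
    refine ⟨{ σ := RingHom.id F, invol := fun _ => rfl, form := f.polarBilin
              refl := fun x y h => by
                simpa [QuadraticMap.polar_comm f y x] using h
              singular := {x | f x = 0}
              smul_mem := fun a x hx => by simp_all [QuadraticMap.map_smul]
              add_mem := fun x hx y hy h => by simp_all
              form_self := fun x hx => by simp_all
              nondeg := fun x hx h => nonsing x hx h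
              lineCount := 1, lineCount_pos := one_pos
              card_line := fun x hx v hv => ?_ },
      fun U => ⟨fun h x hx => ⟨h x hx, fun y hy => ?_⟩, fun h x hx => (h x hx).1⟩⟩
    · have hx' : f x = 0 := hx
      have hv' : QuadraticMap.polar f v x ≠ 0 := by rwa [QuadraticMap.polar_comm]
      -- Since `f x = 0`, `f (v + a • x)` has degree one in `a` and thus exactly one root.
      rw [Nat.card_eq_one_iff_exists]
      refine ⟨⟨-f v / QuadraticMap.polar f v x, ?_⟩, ?_⟩
      · simp [key, hx', QuadraticMap.map_smul, hv']
      · rintro ⟨a, ha⟩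
        have ha' : f v + a * QuadraticMap.polar f v x = 0 := by
          simpa [key, hx', QuadraticMap.map_smul] using ha
        ext
        rw [eq_div_iff hv']
        linear_combination ha'
    · have := key x y
      have h1 : f (x + y) = 0 := h _ (U.add_mem hx hy)
      have h2 : f x = 0 := h _ hx
      have h3 : f y = 0 := h _ hy
      simp_all

end ClassicalPolarSpace

/-! ### Counting singular vectors and blocks. -/

namespace PolarModel

variable {F V : Type*} [Field F] [AddCommGroup V] [Module F V]

/-- The number of singular vectors perpendicular to `U`. -/
def perpCount (M : PolarModel F V) (U : Submodule F V) : ℕ :=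
  (M.singular ∩ M.perp U).ncard

/-- Any vector not perpendicular to `x` can be moved in direction `x` to a singular one, because
`lineCount` is positive. -/
theorem exists_singular_form_ne_zero (M : PolarModel F V) {x : V} (hx : x ∈ M.singular)
    (hx0 : x ≠ 0) : ∃ y ∈ M.singular, M.form x y ≠ 0 := by
  obtain ⟨v, hv⟩ : ∃ v, M.form x v ≠ 0 := by
    by_contra! h
    exact hx0 (M.nondeg x hx h)
  have hpos : 0 < Nat.card {a : F // v + a • x ∈ M.singular} := by
    rw [M.card_line x hx v hv]
    exact M.lineCount_pos
  obtain ⟨⟨a, ha⟩⟩ := (Nat.card_pos_iff.1 hpos).1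
  exact ⟨_, ha, by simpa [M.form_self x hx] using hv⟩

theorem exists_sup_span_singleton_eq [FiniteDimensional F V] {U W : Submodule F V} (h : W ≤ U)
    (hd : Module.finrank F U = Module.finrank F W + 1) :
    ∃ x ∈ U, x ∉ W ∧ W ⊔ (F ∙ x) = U := by
  obtain ⟨x, hxU, hxW⟩ : ∃ x ∈ U, x ∉ W := by
    by_contra! h'
    rw [le_antisymm h' h] at hd
    omega
  refine ⟨x, hxU, hxW, Submodule.eq_of_le_of_finrank_le
    (sup_le h ((Submodule.span_singleton_le_iff_mem _ _).2 hxU)) ?_⟩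
  have hlt : W < W ⊔ (F ∙ x) := lt_of_le_of_ne le_sup_left fun he =>
    hxW (he ▸ (le_sup_right : F ∙ x ≤ W ⊔ (F ∙ x)) (Submodule.mem_span_singleton_self x))
  have := Submodule.finrank_lt_finrank_of_lt hlt
  omega

theorem mem_perp_sup_span_singleton {M : PolarModel F V} {W : Submodule F V} {x v : V} :
    v ∈ M.perp (W ⊔ (F ∙ x)) ↔ v ∈ M.perp W ∧ M.form x v = 0 := by
  refine ⟨fun h => ⟨M.perp_anti le_sup_left h, h x ((le_sup_right : F ∙ x ≤ W ⊔ (F ∙ x))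
    (Submodule.mem_span_singleton_self x))⟩, fun ⟨h1, h2⟩ u hu => ?_⟩
  obtain ⟨w, hw, y, hy, rfl⟩ := Submodule.mem_sup.1 hu
  obtain ⟨a, rfl⟩ := Submodule.mem_span_singleton.1 hy
  simp [h1 w hw, h2]

theorem exists_le_finrank_eq (U : Submodule F V) {d : ℕ} (hd : d ≤ Module.finrank F U) :
    ∃ W ≤ U, Module.finrank F W = d := by
  obtain ⟨f, hf⟩ := exists_linearIndependent_of_le_finrank hd
  refine ⟨Submodule.span F (Set.range fun i => (f i : V)), ?_, ?_⟩
  · rw [Submodule.span_le]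
    rintro _ ⟨i, rfl⟩
    exact (f i).2
  · have h := finrank_span_eq_card (hf.map' U.subtype (Submodule.ker_subtype U))
    rwa [Fintype.card_fin] at h

theorem ncard_coe [FiniteDimensional F V] (U : Submodule F V) :
    (U : Set V).ncard = Nat.card F ^ Module.finrank F U :=
  Module.natCard_eq_pow_finrank (K := F) (V := U)

variable [Finite F] [FiniteDimensional F V]

theorem ncard_sdiff {U W : Submodule F V} (h : W ≤ U) :
    ((U : Set V) \ W).ncard =
      Nat.card F ^ Module.finrank F U - Nat.card F ^ Module.finrank F W := by
  have : Finite V := Module.finite_of_finite F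
  rw [Set.ncard_sdiff h, ncard_coe, ncard_coe]

/-- Write `U = W + ⟨x⟩`. The set `W⊥ \ U⊥` is invariant under translation by multiples of `x`. Count
the pairs `(v, a)` with `v + a • x` singular: each `v` admits `lineCount` scalars, and for each `a`
translation is a bijection onto the singular vectors of the set. -/
theorem ncard_perp_sdiff_mul_lineCount (M : PolarModel F V) {U W : Submodule F V} (hU : M.Mem U)
    (h : W ≤ U) (hd : Module.finrank F U = Module.finrank F W + 1) :
    ((M.perp W : Set V) \ M.perp U).ncard * M.lineCount =
      Nat.card F * (M.perpCount W - M.perpCount U) := by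
  classical
  have : Finite V := Module.finite_of_finite F
  have := Fintype.ofFinite V
  have := Fintype.ofFinite F
  obtain ⟨x, hxU, -, rfl⟩ := exists_sup_span_singleton_eq h hd
  have hxS := (hU x hxU).1
  have hxW : x ∈ M.perp W := M.perp_anti h (hU.le_perp hxU)
  set A : Set V := (M.perp W : Set V) \ M.perp (W ⊔ (F ∙ x)) with hA
  have memA : ∀ v, v ∈ A ↔ v ∈ M.perp W ∧ M.form x v ≠ 0 := fun v => by
    rw [hA, Set.mem_sdiff, SetLike.mem_coe, SetLike.mem_coe, mem_perp_sup_span_singleton]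
    tauto
  have hAx : ∀ a : F, ∀ v ∈ A, v + a • x ∈ A := fun a v hv => by
    rw [memA] at hv ⊢
    exact ⟨Submodule.add_mem _ hv.1 (Submodule.smul_mem _ a hxW), by simpa [M.form_self x hxS] using hv.2⟩
  have hcount : M.perpCount W - M.perpCount (W ⊔ (F ∙ x)) = (M.singular ∩ A).ncard := by
    rw [perpCount, perpCount,
      ← Set.ncard_sdiff (Set.inter_subset_inter_right _ (M.perp_anti le_sup_left))]
    congr 1
    ext v
    simp only [Set.mem_sdiff, Set.mem_inter_iff, hA]
    tauto
  rw [hcount, Set.ncard_eq_toFinset_card', Set.ncard_eq_toFinset_card', Nat.card_eq_fintype_card]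
  refine Finset.card_mul_eq_card_mul (s := A.toFinset) (t := Finset.univ)
    (fun (v : V) (a : F) => v + a • x ∈ M.singular) (fun v hv => ?_) fun a _ => ?_
  · rw [Set.mem_toFinset, memA] at hv
    rw [← M.card_line x hxS v hv.2, Nat.card_eq_fintype_card, Fintype.card_subtype]
    rfl
  · refine Finset.card_bij' (fun v _ => v + a • x) (fun v _ => v + (-a) • x) ?_ ?_ ?_ ?_
    · intro v hv
      simp only [Finset.bipartiteBelow, Finset.mem_filter, Set.mem_toFinset] at hv
      exact Set.mem_toFinset.2 ⟨hv.2, hAx a v hv.1⟩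
    · intro v hv
      rw [Set.mem_toFinset] at hv
      simp only [Finset.bipartiteBelow, Finset.mem_filter, Set.mem_toFinset]
      exact ⟨hAx _ v hv.2, by simpa using hv.1⟩
    · intro v _
      simp
    · intro v _
      simp

/-- The number of singular vectors perpendicular to a totally singular subspace depends only on
the dimension of the subspace. -/
theorem perpCount_eq_of_finrank_eq (M : PolarModel F V) {U U' : Submodule F V} (hU : M.Mem U)
    (hU' : M.Mem U') (h : Module.finrank F U = Module.finrank F U') :
    M.perpCount U = M.perpCount U' := by
  have : Finite V := Module.finite_of_finite F
  induction hs : Module.finrank F U generalizing U U' with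
  | zero =>
    rw [Submodule.finrank_eq_zero.1 hs, Submodule.finrank_eq_zero.1 (h.symm.trans hs)]
  | succ s ih =>
    obtain ⟨W, hW, hWs⟩ := exists_le_finrank_eq U (d := s) (by omega)
    obtain ⟨W', hW', hWs'⟩ := exists_le_finrank_eq U' (d := s) (by omega)
    have h0 := ih (hU.mono hW) (hU'.mono hW') (by omega) hWs
    have h1 := M.ncard_perp_sdiff_mul_lineCount hU hW (by omega)
    have h2 := M.ncard_perp_sdiff_mul_lineCount hU' hW' (by omega)
    have e1 := M.finrank_perp hU
    have e2 := M.finrank_perp hU'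
    have e3 := M.finrank_perp (hU.mono hW)
    have e4 := M.finrank_perp (hU'.mono hW')
    rw [ncard_sdiff (M.perp_anti hW)] at h1
    rw [ncard_sdiff (M.perp_anti hW'),
      show Module.finrank F (M.perp W') = Module.finrank F (M.perp W) by omega,
      show Module.finrank F (M.perp U') = Module.finrank F (M.perp U) by omega, h1] at h2
    -- The sets `W⊥ \ U⊥` and `W'⊥ \ U'⊥` have equal size, so the drops in `perpCount` agree. The
    -- inequalities that follow make the truncated subtractions genuine.
    have h3 := Nat.eq_of_mul_eq_mul_left Nat.card_pos h2
    have l1 : M.perpCount U ≤ M.perpCount W :=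
      Set.ncard_le_ncard (Set.inter_subset_inter_right _ (M.perp_anti hW))
    have l2 : M.perpCount U' ≤ M.perpCount W' :=
      Set.ncard_le_ncard (Set.inter_subset_inter_right _ (M.perp_anti hW'))
    omega

/-- `U` may be replaced by a subspace of `T` of the same dimension, whose perp contains all of `T`.
This keeps the design parameters positive when the strength is lowered. -/
theorem pow_finrank_lt_perpCount (M : PolarModel F V) {U T : Submodule F V} (hU : M.Mem U)
    (hT : M.Mem T) (h : Module.finrank F U < Module.finrank F T) :
    Nat.card F ^ Module.finrank F U < M.perpCount U := by
  have : Finite V := Module.finite_of_finite F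
  obtain ⟨W, hWT, hW⟩ := exists_le_finrank_eq T h.le
  rw [M.perpCount_eq_of_finrank_eq hU (hT.mono hWT) hW.symm]
  calc Nat.card F ^ Module.finrank F U < Nat.card F ^ Module.finrank F T :=
        Nat.pow_lt_pow_right Finite.one_lt_card h
    _ = (T : Set V).ncard := (ncard_coe T).symm
    _ ≤ (M.singular ∩ M.perp W).ncard := Set.ncard_le_ncard fun v (hv : v ∈ T) =>
      ⟨(hT v hv).1, M.perp_anti hWT (hT.le_perp hv)⟩

/-- Double counting of the pairs `(v, B)` with `U ≤ B` and `v ∈ B \ U`. -/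
theorem ncard_blocks_mul (M : PolarModel F V) {k lam : ℕ} {D : Set (Submodule F V)}
    (hD : ∀ B ∈ D, M.Mem B ∧ Module.finrank F B = k) {U : Submodule F V} (hU : M.Mem U)
    (hlam : ∀ T, M.Mem T → Module.finrank F T = Module.finrank F U + 1 →
      {B ∈ D | T ≤ B}.ncard = lam) :
    {B ∈ D | U ≤ B}.ncard * (Nat.card F ^ k - Nat.card F ^ Module.finrank F U) =
      (M.perpCount U - Nat.card F ^ Module.finrank F U) * lam := by
  classical
  have : Finite V := Module.finite_of_finite F
  have := Fintype.ofFinite V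
  have : Finite (Submodule F V) := Finite.of_injective _ SetLike.coe_injective
  have := Fintype.ofFinite (Submodule F V)
  have hR : M.perpCount U - Nat.card F ^ Module.finrank F U =
      ((M.singular ∩ M.perp U) \ U).ncard := by
    have hsub : (U : Set V) ⊆ M.singular ∩ M.perp U := fun v hv =>
      ⟨(hU v hv).1, hU.le_perp hv⟩
    rw [Set.ncard_sdiff hsub, ncard_coe, perpCount]
  rw [hR, Set.ncard_eq_toFinset_card', Set.ncard_eq_toFinset_card']
  refine Finset.card_mul_eq_card_mul (fun (B : Submodule F V) (v : V) => v ∈ B)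
    (fun B hB => ?_) fun v hv => ?_
  · rw [Set.mem_toFinset] at hB
    rw [← (hD B hB.1).2, ← ncard_sdiff hB.2, Set.ncard_eq_toFinset_card']
    congr 1
    ext v
    simp only [Finset.bipartiteAbove, Finset.mem_filter, Set.mem_toFinset, Set.mem_sdiff,
      Set.mem_inter_iff, SetLike.mem_coe]
    have hB' := (hD B hB.1).1
    exact ⟨fun h => ⟨h.2, h.1.2⟩, fun h => ⟨⟨⟨(hB' v h.1).1,
      M.perp_anti hB.2 (hB'.le_perp h.1)⟩, h.2⟩, h.1⟩⟩
  -- A block through `U` contains `v` exactly when it contains `U + ⟨v⟩`, which is totally singular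
  -- of dimension one more.
  · rw [Set.mem_toFinset] at hv
    obtain ⟨⟨hvS, hvp⟩, hvU⟩ := hv
    rw [← hlam (U ⊔ (F ∙ v)) (hU.sup (Mem.span_singleton hvS)
      ((Submodule.span_singleton_le_iff_mem _ _).2 hvp)) ?_, Set.ncard_eq_toFinset_card']
    · congr 1
      ext B
      simp only [Finset.bipartiteBelow, Finset.mem_filter, Set.mem_toFinset, Set.mem_ofPred_eq,
        sup_le_iff, Submodule.span_singleton_le_iff_mem]
      tauto
    · exact Submodule.finrank_sup_span_singleton hvU

end PolarModel

/-! ### Hyperplanes of generators, and designs of smaller strength. -/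

namespace PolarModel

variable {F V : Type*} [Field F] [AddCommGroup V] [Module F V] [FiniteDimensional F V]

/-- The subspace of the vectors of a maximal totally singular subspace which are perpendicular to
a singular vector outside of it is a hyperplane. -/
theorem finrank_inf_perp_span_singleton (M : PolarModel F V) {G : Submodule F V} (hG : M.Mem G)
    (hmax : ∀ U, M.Mem U → Module.finrank F U ≤ Module.finrank F G) {x : V}
    (hx : x ∈ M.singular) (hxG : x ∉ G) :
    Module.finrank F (G ⊓ M.perp (F ∙ x) : Submodule F V) + 1 = Module.finrank F G := by
  have hne : (M.form x).domRestrict G ≠ 0 := by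
    intro h0
    have hle : F ∙ x ≤ M.perp G := (Submodule.span_singleton_le_iff_mem _ _).2 fun u hu =>
      M.refl _ _ (LinearMap.congr_fun h0 ⟨u, hu⟩)
    have := hmax _ (hG.sup (Mem.span_singleton hx) hle)
    rw [Submodule.finrank_sup_span_singleton hxG] at this
    omega
  have hker : (LinearMap.ker ((M.form x).domRestrict G)).map G.subtype =
      G ⊓ M.perp (F ∙ x) := by
    ext v
    have : v ∈ M.perp (F ∙ x) ↔ M.form x v = 0 := by
      have h := mem_perp_sup_span_singleton (M := M) (W := ⊥) (x := x) (v := v)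
      rw [bot_sup_eq] at h
      rw [h]
      simp [mem_perp]
    simp [this, and_comm]
  rw [← hker, Submodule.finrank_map_subtype_eq]
  exact Module.Dual.finrank_ker_add_one_of_ne_zero hne

variable [Finite F]

/-- A `t`-design in a polar space is an `s`-design for every `s ≤ t`. -/
theorem exists_ncard_blocks_eq (M : PolarModel F V) {k s t lam : ℕ} {D : Set (Submodule F V)}
    (hD : ∀ B ∈ D, M.Mem B ∧ Module.finrank F B = k) (hst : s ≤ t) (htk : t ≤ k)
    {G : Submodule F V} (hG : M.Mem G) (hGt : t ≤ Module.finrank F G) (hlam0 : 0 < lam)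
    (hlam : ∀ T, M.Mem T → Module.finrank F T = t → {B ∈ D | T ≤ B}.ncard = lam) :
    ∃ lam' > 0, ∀ U, M.Mem U → Module.finrank F U = s → {B ∈ D | U ≤ B}.ncard = lam' := by
  induction hst using Nat.decreasingInduction with
  | self => exact ⟨lam, hlam0, hlam⟩
  | of_succ s hs ih =>
    obtain ⟨l, hl, h⟩ := ih
    have key : ∀ U, M.Mem U → Module.finrank F U = s →
        {B ∈ D | U ≤ B}.ncard * (Nat.card F ^ k - Nat.card F ^ s) =
          (M.perpCount U - Nat.card F ^ s) * l := fun U hU hUs => by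
      have := M.ncard_blocks_mul hD hU (lam := l) fun T hT hTs => h T hT (by omega)
      rwa [hUs] at this
    obtain ⟨U₀, hU₀, hUs⟩ := exists_le_finrank_eq G (d := s) (by omega)
    have hM₀ := hG.mono hU₀
    have hpos : 0 < Nat.card F ^ k - Nat.card F ^ s :=
      Nat.sub_pos_of_lt (Nat.pow_lt_pow_right Finite.one_lt_card (by omega))
    refine ⟨{B ∈ D | U₀ ≤ B}.ncard, Nat.pos_of_ne_zero fun h0 => ?_, fun U hU hs' => ?_⟩
    · have h1 := key U₀ hM₀ hUs
      have h2 := M.pow_finrank_lt_perpCount hM₀ hG (by omega)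
      rw [hUs] at h2
      rw [h0, zero_mul] at h1
      exact (Nat.mul_pos (Nat.sub_pos_of_lt h2) hl).ne h1
    · refine Nat.eq_of_mul_eq_mul_right hpos ?_
      rw [key U hU hs', key U₀ hM₀ hUs, M.perpCount_eq_of_finrank_eq hU hM₀ (by omega)]

end PolarModel

/-! ### Points and the incidence map. -/

namespace ClassicalPolarSpace

open Classical

variable {F V : Type*} [Field F] [AddCommGroup V] [Module F V] [FiniteDimensional F V]
  (𝒬 : ClassicalPolarSpace F V)

theorem finrank_le_rank {U : Submodule F V} (hU : 𝒬.Mem U) : Module.finrank F U ≤ 𝒬.rank :=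
  le_csSup ⟨Module.finrank F V, fun _ ⟨U, _, h⟩ => h ▸ Submodule.finrank_le U⟩ ⟨U, hU, rfl⟩

theorem exists_finrank_eq_rank : ∃ G, 𝒬.Mem G ∧ Module.finrank F G = 𝒬.rank := by
  refine Nat.sSup_mem (s := {d | ∃ U : Submodule F V, 𝒬.Mem U ∧ Module.finrank F U = d})
    ⟨0, ⊥, ?_, finrank_bot F V⟩ ⟨Module.finrank F V, fun _ ⟨U, _, h⟩ => h ▸ Submodule.finrank_le U⟩
  cases 𝒬 <;> simp [Mem]

theorem exists_point_eq_span (P : 𝒬.Point) : ∃ x, x ≠ 0 ∧ P.1 = F ∙ x := by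
  obtain ⟨x, hx, h⟩ := finrank_eq_one_iff'.1 P.2.2
  refine ⟨x, by simpa using hx, le_antisymm (fun y hy => ?_)
    ((Submodule.span_singleton_le_iff_mem _ _).2 x.2)⟩
  obtain ⟨c, hc⟩ := h ⟨y, hy⟩
  exact Submodule.mem_span_singleton.2 ⟨c, congrArg Subtype.val hc⟩

theorem point_le_iff_eq {P Q : 𝒬.Point} : P.1 ≤ Q.1 ↔ P = Q :=
  ⟨fun h => Subtype.ext (Submodule.eq_of_le_of_finrank_eq h (P.2.2.trans Q.2.2.symm)),
    fun h => h ▸ le_rfl⟩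

theorem finrank_sup_eq_two {P Q : 𝒬.Point} (h : P ≠ Q) :
    Module.finrank F (P.1 ⊔ Q.1 : Submodule F V) = 2 := by
  obtain ⟨x, hx, hQ⟩ := 𝒬.exists_point_eq_span Q
  have hxP : x ∉ P.1 := fun hxP => h ((𝒬.point_le_iff_eq.1
    (hQ.le.trans ((Submodule.span_singleton_le_iff_mem _ _).2 hxP))).symm)
  rw [hQ, Submodule.finrank_sup_span_singleton hxP, P.2.2]

variable [Finite F]

theorem adjacency_apply (x : 𝒬.Point → ℝ) (Q : 𝒬.Point) :
    𝒬.adjacency x Q = ∑ P, if 𝒬.collinearityGraph.Adj Q P then x P else 0 := by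
  rw [adjacency, Matrix.toLin'_apply, SimpleGraph.adjMatrix_mulVec_apply, ← Finset.sum_filter,
    SimpleGraph.neighborFinset_eq_filter]

/-- Each point has `q - 1` nonzero vectors, and each nonzero vector of `W` spans one point. -/
theorem card_points_le_mul {W : Submodule F V} (hW : ∀ x ∈ W, 𝒬.Mem (F ∙ x)) :
    (Finset.univ.filter fun P : 𝒬.Point => P.1 ≤ W).card * (Nat.card F - 1) =
      Nat.card F ^ Module.finrank F W - 1 := by
  have : Finite V := Module.finite_of_finite F
  have := Fintype.ofFinite V
  have hz : ∀ U : Submodule F V, ((U : Set V) \ {0}).ncard =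
      Nat.card F ^ Module.finrank F U - 1 := fun U => by
    have := PolarModel.ncard_sdiff (bot_le (a := U))
    rwa [finrank_bot, pow_zero, Submodule.bot_coe] at this
  rw [← hz W, Set.ncard_eq_toFinset_card', ← mul_one (Finset.card (Set.toFinset _))]
  refine Finset.card_mul_eq_card_mul (fun (P : 𝒬.Point) (v : V) => v ∈ P.1)
    (fun P hP => ?_) fun v hv => ?_
  · have h1 := hz P.1
    rw [P.2.2, pow_one] at h1
    rw [← h1, Set.ncard_eq_toFinset_card']
    congr 1
    ext v
    have : v ∈ P.1 → v ∈ W := fun h => (Finset.mem_filter.1 hP).2 h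
    simp only [Finset.bipartiteAbove, Finset.mem_filter, Set.mem_toFinset, Set.mem_sdiff,
      SetLike.mem_coe, Set.mem_singleton_iff]
    tauto
  · simp only [Set.mem_toFinset, Set.mem_sdiff, SetLike.mem_coe, Set.mem_singleton_iff] at hv
    refine Finset.card_eq_one.2 ⟨⟨F ∙ v, hW v hv.1, finrank_span_singleton hv.2⟩, ?_⟩
    ext P
    simp only [Finset.bipartiteBelow, Finset.mem_filter, Finset.mem_univ, true_and,
      Finset.mem_singleton]
    refine ⟨fun h => (𝒬.point_le_iff_eq.1
      ((Submodule.span_singleton_le_iff_mem _ _).2 h.2)).symm, ?_⟩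
    rintro rfl
    exact ⟨(Submodule.span_singleton_le_iff_mem _ _).2 hv.1, Submodule.mem_span_singleton_self v⟩

theorem cast_card_points_le_mul {W : Submodule F V} (hW : 𝒬.Mem W) :
    ((Finset.univ.filter fun P : 𝒬.Point => P.1 ≤ W).card : ℝ) * ((Nat.card F : ℝ) - 1) =
      (Nat.card F : ℝ) ^ Module.finrank F W - 1 := by
  obtain ⟨M, hM⟩ := 𝒬.exists_model
  have h := 𝒬.card_points_le_mul (W := W) fun x hx =>
    (hM _).2 (((hM W).1 hW).mono ((Submodule.span_singleton_le_iff_mem _ _).2 hx))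
  have h' := congrArg (Nat.cast : ℕ → ℝ) h
  rwa [Nat.cast_mul, Nat.cast_sub Nat.card_pos, Nat.cast_sub (Nat.pow_pos Nat.card_pos),
    Nat.cast_pow, Nat.cast_one] at h'

omit [FiniteDimensional F V] [Finite F] in
theorem sum_ite_le_eq_ncard (D : Set (Submodule F V)) [Fintype D] (U : Submodule F V) :
    ∑ B : D, (if U ≤ B.1 then (1 : ℝ) else 0) = ({B ∈ D | U ≤ B}.ncard : ℝ) := by
  rw [Finset.sum_boole, Nat.cast_inj, ← Set.ncard_coe_finset,
    ← Set.ncard_image_of_injective _ Subtype.val_injective]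
  congr 1
  ext B
  simp [and_comm]

/-- The transposed incidence map: a function on points is summed over the points of a block. -/
def blockSum (D : Set (Submodule F V)) : (𝒬.Point → ℝ) →ₗ[ℝ] (D → ℝ) where
  toFun x B := ∑ P, if P.1 ≤ B.1 then x P else 0
  map_add' x y := by
    ext B
    simp only [Pi.add_apply, ← Finset.sum_add_distrib]
    exact Finset.sum_congr rfl fun P _ => by split_ifs <;> simp
  map_smul' c x := by
    ext B
    simp only [Pi.smul_apply, smul_eq_mul, RingHom.id_apply, Finset.mul_sum]
    exact Finset.sum_congr rfl fun P _ => by split_ifs <;> simp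

theorem blockSum_apply (D : Set (Submodule F V)) (x : 𝒬.Point → ℝ) (B : D) :
    𝒬.blockSum D x B = ∑ P, if P.1 ≤ B.1 then x P else 0 := rfl

section Design

variable {𝒬} {D : Set (Submodule F V)} [Fintype D] {l₁ l₂ : ℕ}

/-- `N Nᵀ = l₁ I + l₂ A` for the incidence matrix `N`. -/
theorem sum_blockSum_eq
    (hD : ∀ B ∈ D, 𝒬.Mem B) (h₁ : ∀ P ∈ 𝒬.subspaces 1, {B ∈ D | P ≤ B}.ncard = l₁)
    (h₂ : ∀ T ∈ 𝒬.subspaces 2, {B ∈ D | T ≤ B}.ncard = l₂)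
    (x : 𝒬.Point → ℝ) (Q : 𝒬.Point) :
    ∑ B : D, (if Q.1 ≤ B.1 then 𝒬.blockSum D x B else 0) = l₁ * x Q + l₂ * 𝒬.adjacency x Q := by
  obtain ⟨M, hM⟩ := 𝒬.exists_model
  have hpair : ∀ P : 𝒬.Point, ∑ B : D, (if Q.1 ≤ B.1 then (if P.1 ≤ B.1 then x P else 0) else 0) =
      (if P = Q then l₁ * x P else 0) +
        l₂ * (if 𝒬.collinearityGraph.Adj Q P then x P else 0) := by
    intro P
    have hsup : ∑ B : D, (if Q.1 ≤ B.1 then (if P.1 ≤ B.1 then x P else 0) else 0) =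
        ({B ∈ D | Q.1 ⊔ P.1 ≤ B}.ncard : ℝ) * x P := by
      rw [← sum_ite_le_eq_ncard, Finset.sum_mul]
      refine Finset.sum_congr rfl fun B _ => ?_
      simp only [sup_le_iff]
      split_ifs <;> simp_all
    rw [hsup]
    by_cases hPQ : P = Q
    · subst hPQ
      rw [sup_idem, h₁ _ P.2]
      simp
    · rw [if_neg hPQ, zero_add]
      by_cases hadj : 𝒬.collinearityGraph.Adj Q P
      · rw [if_pos hadj, h₂ _ ⟨hadj.2, 𝒬.finrank_sup_eq_two hadj.1⟩]
      · rw [if_neg hadj, mul_zero]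
        have hempty : {B ∈ D | Q.1 ⊔ P.1 ≤ B} = ∅ := by
          ext B
          simp only [Set.mem_ofPred_eq, Set.mem_empty_iff_false, iff_false]
          rintro ⟨hB, hle⟩
          exact hadj ⟨fun h => hPQ h.symm, (hM _).2 (((hM B).1 (hD B hB)).mono hle)⟩
        rw [hempty]
        simp
  calc _ = ∑ P, ∑ B : D, (if Q.1 ≤ B.1 then (if P.1 ≤ B.1 then x P else 0) else 0) := by
        rw [Finset.sum_comm]
        refine Finset.sum_congr rfl fun B _ => ?_
        rw [blockSum_apply]
        split_ifs <;> simp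
    _ = _ := by
        rw [Finset.sum_congr rfl fun P _ => hpair P, Finset.sum_add_distrib, ← Finset.mul_sum,
          ← 𝒬.adjacency_apply]
        simp

/-- This is `|Nᵀ x|² = xᵀ (N Nᵀ) x`. -/
theorem sum_sq_blockSum_eq
    (hD : ∀ B ∈ D, 𝒬.Mem B) (h₁ : ∀ P ∈ 𝒬.subspaces 1, {B ∈ D | P ≤ B}.ncard = l₁)
    (h₂ : ∀ T ∈ 𝒬.subspaces 2, {B ∈ D | T ≤ B}.ncard = l₂)
    (x : 𝒬.Point → ℝ) :
    ∑ B : D, 𝒬.blockSum D x B ^ 2 = l₁ * ∑ P, x P ^ 2 + l₂ * ∑ P, x P * 𝒬.adjacency x P := by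
  calc _ = ∑ P, x P * ∑ B : D, (if P.1 ≤ B.1 then 𝒬.blockSum D x B else 0) := by
        simp only [Finset.mul_sum]
        rw [Finset.sum_comm]
        refine Finset.sum_congr rfl fun B _ => ?_
        rw [sq]
        nth_rewrite 1 [blockSum_apply]
        rw [Finset.sum_mul]
        exact Finset.sum_congr rfl fun P _ => by split_ifs <;> simp
    _ = _ := by
        simp only [sum_blockSum_eq hD h₁ h₂, Finset.mul_sum]
        rw [← Finset.sum_add_distrib]
        exact Finset.sum_congr rfl fun P _ => by ring

end Design

end ClassicalPolarSpace

/-! ### Injectivity for `k < r`, and the eigenvalue argument for `k = r`. -/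

namespace ClassicalPolarSpace

open Classical

variable {F V : Type*} [Field F] [AddCommGroup V] [Module F V] [Finite F] [FiniteDimensional F V]
  {𝒬 : ClassicalPolarSpace F V}

/-- A `t`-design with `t ≥ 2` is a `1`-design and a `2`-design; the ratio of the two parameters is
determined by the dimension of the blocks. -/
theorem exists_ncard_blocks_point_line (M : PolarModel F V) (hM : ∀ U, 𝒬.Mem U ↔ M.Mem U)
    {t k lam : ℕ} {D : Set (Submodule F V)} (hD : D ⊆ 𝒬.subspaces k) (ht : 2 ≤ t)
    (htr : t ≤ 𝒬.rank) (hlam0 : 0 < lam)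
    (hlam : ∀ T ∈ 𝒬.subspaces t, {B ∈ D | T ≤ B}.ncard = lam) :
    2 ≤ k ∧ ∃ l₁ > 0, ∃ l₂ > 0, (∀ P ∈ 𝒬.subspaces 1, {B ∈ D | P ≤ B}.ncard = l₁) ∧
      (∀ T ∈ 𝒬.subspaces 2, {B ∈ D | T ≤ B}.ncard = l₂) ∧
      ∀ P ∈ 𝒬.subspaces 1, l₁ * (Nat.card F ^ k - Nat.card F) =
        (M.perpCount P - Nat.card F) * l₂ := by
  obtain ⟨G, hG, hGr⟩ := 𝒬.exists_finrank_eq_rank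
  have hD' : ∀ B ∈ D, M.Mem B ∧ Module.finrank F B = k := fun B hB =>
    ⟨(hM B).1 (hD hB).1, (hD hB).2⟩
  have hlam' : ∀ T, M.Mem T → Module.finrank F T = t → {B ∈ D | T ≤ B}.ncard = lam :=
    fun T hT hTt => hlam T ⟨(hM T).2 hT, hTt⟩
  rw [hM] at hG
  have htk : t ≤ k := by
    obtain ⟨T, hTG, hT⟩ := PolarModel.exists_le_finrank_eq G (d := t) (by omega)
    obtain ⟨B, hB, hTB⟩ : {B ∈ D | T ≤ B}.Nonempty := by
      refine Set.nonempty_of_ncard_ne_zero ?_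
      rw [hlam' T (hG.mono hTG) hT]
      exact hlam0.ne'
    rw [← hT, ← (hD hB).2]
    exact Submodule.finrank_mono hTB
  obtain ⟨l₁, hl₁, h₁⟩ := M.exists_ncard_blocks_eq hD' (s := 1) (by omega) htk hG (by omega)
    hlam0 hlam'
  obtain ⟨l₂, hl₂, h₂⟩ := M.exists_ncard_blocks_eq hD' ht htk hG (by omega) hlam0 hlam'
  refine ⟨ht.trans htk, l₁, hl₁, l₂, hl₂, fun P hP => h₁ P ((hM P).1 hP.1) hP.2,
    fun T hT => h₂ T ((hM T).1 hT.1) hT.2, fun P hP => ?_⟩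
  have h := M.ncard_blocks_mul hD' ((hM P).1 hP.1) (lam := l₂) fun T hT hT2 =>
    h₂ T hT (by rw [hT2, hP.2])
  rwa [h₁ P ((hM P).1 hP.1) hP.2, hP.2, pow_one] at h

theorem IsDesign.injective_blockSum {t r k lam : ℕ} {D : Set (Submodule F V)}
    (hD : 𝒬.IsDesign t r k lam D) (ht : 2 ≤ t) (hlam : 1 ≤ lam) (hkr : k < r) :
    Function.Injective (𝒬.blockSum D) := by
  have : Finite V := Module.finite_of_finite F
  have : Finite (Submodule F V) := Finite.of_injective _ SetLike.coe_injective
  obtain ⟨M, hM⟩ := 𝒬.exists_model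
  have htr : t ≤ 𝒬.rank := hD.rank_eq ▸ hD.t_le
  obtain ⟨hk, l₁, hl₁, l₂, hl₂, h₁, h₂, h₁₂⟩ :=
    exists_ncard_blocks_point_line M hM hD.subset ht htr hlam hD.ncard_eq
  -- The generators form an `r`-design with `λ = 1`: each one contains only itself among them.
  obtain ⟨-, g₁, hg₁, g₂, hg₂, k₁, k₂, k₁₂⟩ :=
    exists_ncard_blocks_point_line M hM (D := 𝒬.subspaces r) (t := r) (lam := 1) subset_rfl
      (by omega) hD.rank_eq.ge one_pos fun T hT => by
        rw [Set.ncard_eq_one]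
        refine ⟨T, Set.ext fun B => ⟨fun h => ?_, ?_⟩⟩
        swap
        · rintro rfl
          exact ⟨hT, le_rfl⟩
        exact (Submodule.eq_of_le_of_finrank_eq h.2 (hT.2.trans h.1.2.symm)).symm
  have := Fintype.ofFinite D
  have := Fintype.ofFinite (𝒬.subspaces r)
  rw [← LinearMap.ker_eq_bot, LinearMap.ker_eq_bot']
  intro x hx
  have e₁ := sum_sq_blockSum_eq (fun B hB => (hD.subset hB).1) h₁ h₂ x
  have e₂ := sum_sq_blockSum_eq (D := 𝒬.subspaces r) (fun B hB => hB.1) k₁ k₂ x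
  have hpos : 0 ≤ ∑ B, 𝒬.blockSum (𝒬.subspaces r) x B ^ 2 :=
    Finset.sum_nonneg fun _ _ => sq_nonneg _
  rw [e₂] at hpos
  simp only [hx, Pi.zero_apply, zero_pow two_ne_zero, Finset.sum_const_zero] at e₁
  set X := ∑ P, x P ^ 2
  set Y := ∑ P, x P * 𝒬.adjacency x P
  by_contra hne
  obtain ⟨P, hP⟩ := Function.ne_iff.1 hne
  have hX : 0 < X := Finset.sum_pos' (fun _ _ => sq_nonneg _)
    ⟨P, Finset.mem_univ _, sq_pos_of_ne_zero hP⟩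
  have hq : 1 < Nat.card F := Finite.one_lt_card
  have a0 : 0 < Nat.card F ^ k - Nat.card F :=
    Nat.sub_pos_of_lt (by simpa using Nat.pow_lt_pow_right hq hk)
  have hab : Nat.card F ^ k - Nat.card F < Nat.card F ^ r - Nat.card F := by
    have := Nat.pow_lt_pow_right hq hkr
    omega
  -- Both `l₁ (q^k - q) / l₂` and `g₁ (q^r - q) / g₂` equal `M.perpCount P - q`, and `q^k < q^r`.
  have hlg : l₂ * g₁ < g₂ * l₁ := by
    refine lt_of_mul_lt_mul_right ?_ (Nat.zero_le (Nat.card F ^ r - Nat.card F))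
    calc l₂ * g₁ * (Nat.card F ^ r - Nat.card F)
        = g₂ * (l₁ * (Nat.card F ^ k - Nat.card F)) := by
          rw [h₁₂ P.1 P.2, mul_assoc, k₁₂ P.1 P.2]
          ring
      _ < g₂ * (l₁ * (Nat.card F ^ r - Nat.card F)) := by gcongr
      _ = _ := by ring
  have hlg' : (l₂ : ℝ) * g₁ < g₂ * l₁ := by exact_mod_cast hlg
  have hl₂' : (0 : ℝ) < l₂ := by exact_mod_cast hl₂
  -- Eliminating `Y` gives `l₂ (g₁ X + g₂ Y) = (l₂ g₁ - g₂ l₁) X < 0`.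
  nlinarith [mul_pos (sub_pos.2 hlg') hX, mul_nonneg hl₂'.le hpos]

/-- If `A 1 = d` and `A χ = θ χ + h` for constants `d`, `θ`, `h ≠ 0` and a function `χ` with a
zero, then `(θ - d) χ + h` is an eigenvector of `A` with eigenvalue `θ`. -/
theorem hasEigenvalue_of_apply_eq {ι : Type*} (A : Module.End ℝ (ι → ℝ)) {θ d h : ℝ}
    {χ : ι → ℝ} (h1 : A 1 = d • 1) (hχ : A χ = θ • χ + h • 1) (hh : h ≠ 0) {P : ι}
    (hP : χ P = 0) : A.HasEigenvalue θ := by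
  refine Module.End.hasEigenvalue_of_hasEigenvector (x := (θ - d) • χ + h • (1 : ι → ℝ))
    ⟨Module.End.mem_eigenspace_iff.2 ?_, fun h0 => hh ?_⟩
  · rw [map_add, map_smul, map_smul, h1, hχ]
    module
  · simpa [hP] using congrFun h0 P

/-- The number of points of a generator collinear with a given point. -/
theorem adjacency_indicator_apply {G : Submodule F V} (hG : 𝒬.Mem G)
    (hr : Module.finrank F G = 𝒬.rank) {c c' : ℝ}
    (hc : c * ((Nat.card F : ℝ) - 1) = (Nat.card F : ℝ) ^ 𝒬.rank - 1)
    (hc' : c' * ((Nat.card F : ℝ) - 1) = (Nat.card F : ℝ) ^ (𝒬.rank - 1) - 1) (Q : 𝒬.Point) :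
    𝒬.adjacency (fun P => if P.1 ≤ G then 1 else 0) Q = if Q.1 ≤ G then c - 1 else c' := by
  obtain ⟨M, hM⟩ := 𝒬.exists_model
  have hq : (1 : ℝ) < Nat.card F := by exact_mod_cast Finite.one_lt_card (α := F)
  have hq0 : (Nat.card F : ℝ) - 1 ≠ 0 := by linarith
  have hMG := (hM G).1 hG
  have hpts : ∀ W ≤ G, ((Finset.univ.filter fun P : 𝒬.Point => P.1 ≤ W).card : ℝ) *
      ((Nat.card F : ℝ) - 1) = (Nat.card F : ℝ) ^ Module.finrank F W - 1 := fun W hW => by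
    exact 𝒬.cast_card_points_le_mul ((hM _).2 (hMG.mono hW))
  have hsum : 𝒬.adjacency (fun P => if P.1 ≤ G then 1 else 0) Q =
      ((Finset.univ.filter fun P : 𝒬.Point =>
        𝒬.collinearityGraph.Adj Q P ∧ P.1 ≤ G).card : ℝ) := by
    rw [adjacency_apply, ← Finset.sum_boole]
    exact Finset.sum_congr rfl fun P _ => by rw [ite_and]
  rw [hsum]
  by_cases hQ : Q.1 ≤ G
  · rw [if_pos hQ]
    have hset : (Finset.univ.filter fun P : 𝒬.Point =>
        𝒬.collinearityGraph.Adj Q P ∧ P.1 ≤ G) =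
        (Finset.univ.filter fun P : 𝒬.Point => P.1 ≤ G).erase Q := by
      ext P
      simp only [Finset.mem_filter, Finset.mem_univ, true_and, Finset.mem_erase]
      refine ⟨fun h => ⟨h.1.1.symm, h.2⟩, fun h => ⟨⟨h.1.symm, (hM _).2 (hMG.mono ?_)⟩, h.2⟩⟩
      exact sup_le hQ h.2
    rw [hset, Finset.cast_card_erase_of_mem (by simpa using hQ)]
    congr 1
    refine mul_right_cancel₀ hq0 ?_
    rw [hpts G le_rfl, hc, hr]
  -- Off `G`, the points of `G` collinear with `Q` are those of the hyperplane `G ∩ Q⊥`.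
  · rw [if_neg hQ]
    obtain ⟨x, -, hx⟩ := 𝒬.exists_point_eq_span Q
    have hMQ := (hM _).1 Q.2.1
    have hxQ : x ∈ Q.1 := hx ▸ Submodule.mem_span_singleton_self x
    have hset : (Finset.univ.filter fun P : 𝒬.Point =>
        𝒬.collinearityGraph.Adj Q P ∧ P.1 ≤ G) =
        Finset.univ.filter fun P : 𝒬.Point => P.1 ≤ G ⊓ M.perp Q.1 := by
      ext P
      simp only [Finset.mem_filter, Finset.mem_univ, true_and, le_inf_iff]
      refine ⟨fun h => ⟨h.2, ?_⟩, fun h => ⟨⟨fun e => hQ (e ▸ h.1), (hM _).2 ?_⟩, h.1⟩⟩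
      · exact le_sup_right.trans
          (((hM _).1 h.1.2).le_perp.trans (M.perp_anti le_sup_left))
      · exact hMQ.sup ((hM _).1 P.2.1) h.2
    rw [hset]
    refine mul_right_cancel₀ hq0 ?_
    rw [hpts _ inf_le_left, hc']
    have hfin := M.finrank_inf_perp_span_singleton hMG
      (fun U hU => hr ▸ 𝒬.finrank_le_rank ((hM U).2 hU)) (hMQ x hxQ).1
      (fun h => hQ (hx ▸ (Submodule.span_singleton_le_iff_mem _ _).2 h))
    rw [hx, show 𝒬.rank - 1 = _ from Nat.sub_eq_of_eq_add (hr.symm.trans hfin.symm)]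

/-- Regularity of the graph is read off from the design: blocks have a constant number `c` of
points, so `N Nᵀ 1 = c l₁ 1`, and `N Nᵀ = l₁ I + l₂ A` can be solved for `A 1`. -/
theorem IsDesign.exists_adjacency_one {t r k lam : ℕ} {D : Set (Submodule F V)}
    (hD : 𝒬.IsDesign t r k lam D) (ht : 2 ≤ t) (hlam : 1 ≤ lam) :
    ∃ d : ℝ, 𝒬.adjacency 1 = d • 1 := by
  have : Finite V := Module.finite_of_finite F
  have : Finite (Submodule F V) := Finite.of_injective _ SetLike.coe_injective
  have := Fintype.ofFinite D
  obtain ⟨M, hM⟩ := 𝒬.exists_model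
  obtain ⟨hk, l₁, hl₁, l₂, hl₂, h₁, h₂, -⟩ :=
    exists_ncard_blocks_point_line M hM hD.subset ht (hD.rank_eq ▸ hD.t_le) hlam hD.ncard_eq
  have hq : (1 : ℝ) < Nat.card F := by exact_mod_cast Finite.one_lt_card (α := F)
  have hq0 : (Nat.card F : ℝ) - 1 ≠ 0 := by linarith
  set c : ℝ := ((Nat.card F : ℝ) ^ k - 1) / ((Nat.card F : ℝ) - 1) with hc
  have hB : ∀ B : D, 𝒬.blockSum D 1 B = c := fun B => by
    have h := 𝒬.cast_card_points_le_mul (hD.subset B.2).1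
    rw [(hD.subset B.2).2] at h
    rw [hc, eq_div_iff hq0, ← h, blockSum_apply, ← Finset.sum_boole]
    rfl
  refine ⟨(c * l₁ - l₁) / l₂, funext fun Q => ?_⟩
  have hl₂' : (l₂ : ℝ) ≠ 0 := by exact_mod_cast hl₂.ne'
  have e := sum_blockSum_eq (fun B hB => (hD.subset hB).1) h₁ h₂ 1 Q
  have e' : ∑ B : D, (if Q.1 ≤ B.1 then 𝒬.blockSum D 1 B else 0) = c * l₁ := by
    rw [← h₁ _ Q.2, ← sum_ite_le_eq_ncard, Finset.mul_sum]
    exact Finset.sum_congr rfl fun B _ => by rw [hB]; split_ifs <;> simp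
  rw [e'] at e
  simp only [Pi.one_apply, Pi.smul_apply, smul_eq_mul, mul_one] at e ⊢
  rw [eq_div_iff hl₂']
  linarith

/-- On the eigenspace and on the constants `N Nᵀ` is multiplication by `l₁ + l₂ θ` and `l₁ + l₂ d`,
both positive. As `d ≠ θ`, the two spaces meet trivially, so `Nᵀ` is injective on their direct sum.
-/
theorem one_add_finrank_eigenspace_le {D : Set (Submodule F V)} [Fintype D] {l₁ l₂ : ℕ}
    (hD : ∀ B ∈ D, 𝒬.Mem B) (h₁ : ∀ P ∈ 𝒬.subspaces 1, {B ∈ D | P ≤ B}.ncard = l₁)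
    (h₂ : ∀ T ∈ 𝒬.subspaces 2, {B ∈ D | T ≤ B}.ncard = l₂) (hl₁ : 0 < l₁) {θ d : ℝ}
    (hθ : 0 ≤ θ) (hd : 0 ≤ d) (hne : d ≠ θ) (h1 : 𝒬.adjacency 1 = d • 1) [Nonempty 𝒬.Point] :
    1 + Module.finrank ℝ (𝒬.adjacency.eigenspace θ) ≤ Fintype.card D := by
  let L : (𝒬.adjacency.eigenspace θ × ℝ) →ₗ[ℝ] (𝒬.Point → ℝ) :=
    (𝒬.adjacency.eigenspace θ).subtype.coprod (LinearMap.toSpanSingleton ℝ _ 1)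
  have hL : ∀ u c, L (u, c) = u.1 + c • (1 : 𝒬.Point → ℝ) := fun u c => by simp [L]
  have hinj : Function.Injective (𝒬.blockSum D ∘ₗ L) := by
    rw [← LinearMap.ker_eq_bot, LinearMap.ker_eq_bot']
    rintro ⟨u, c⟩ h0
    rw [LinearMap.comp_apply, hL] at h0
    have hu : 𝒬.adjacency u.1 = θ • u.1 := Module.End.mem_eigenspace_iff.1 u.2
    have hAx : 𝒬.adjacency (u.1 + c • (1 : 𝒬.Point → ℝ)) = θ • u.1 + (c * d) • 1 := by
      rw [map_add, map_smul, h1, hu, smul_smul]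
    have hα : 0 < l₁ + l₂ * θ := by positivity
    have hβ : 0 < l₁ + l₂ * d := by positivity
    have hcomb : ∀ Q, (l₁ + l₂ * θ) * u.1 Q + (l₁ + l₂ * d) * c = 0 := fun Q => by
      have e := sum_blockSum_eq hD h₁ h₂ (u.1 + c • (1 : 𝒬.Point → ℝ)) Q
      rw [h0, hAx] at e
      simp only [Pi.zero_apply, ite_self, Finset.sum_const_zero, Pi.add_apply, Pi.smul_apply,
        Pi.one_apply, smul_eq_mul, mul_one] at e
      linarith
    have hconst : u.1 = (-((l₁ + l₂ * d) * c) / (l₁ + l₂ * θ)) • (1 : 𝒬.Point → ℝ) := by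
      ext Q
      simp only [Pi.smul_apply, Pi.one_apply, smul_eq_mul, mul_one]
      rw [eq_div_iff hα.ne']
      linarith [hcomb Q]
    obtain ⟨Q⟩ := ‹Nonempty 𝒬.Point›
    have hu0 : ∀ Q, u.1 Q = 0 := fun Q => by
      have e := congrFun hu Q
      rw [hconst, map_smul, h1] at e
      simp only [Pi.smul_apply, Pi.one_apply, smul_eq_mul, mul_one] at e
      rw [hconst]
      simp only [Pi.smul_apply, Pi.one_apply, smul_eq_mul, mul_one]
      refine (mul_eq_zero.1 (?_ : _ * (d - θ) = 0)).resolve_right (sub_ne_zero.2 hne)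
      linarith
    have hc0 : c = 0 := by
      have e := hcomb Q
      rw [hu0 Q, mul_zero, zero_add] at e
      exact (mul_eq_zero.1 e).resolve_left hβ.ne'
    exact Prod.ext (Subtype.ext (funext hu0)) hc0
  have := LinearMap.finrank_le_finrank_of_injective hinj
  rwa [Module.finrank_prod, Module.finrank_self, Module.finrank_fintype_fun_eq_card, add_comm]
    at this

/-- In a polar space of rank at least two, the collinearity graph of which is regular, the number
`q ^ (r - 1) - 1` is an eigenvalue different from the degree. -/
theorem hasEigenvalue_and_lt_degree (hr : 2 ≤ 𝒬.rank) {d : ℝ} (h1 : 𝒬.adjacency 1 = d • 1) :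
    𝒬.adjacency.HasEigenvalue ((Nat.card F : ℝ) ^ (𝒬.rank - 1) - 1) ∧
      (Nat.card F : ℝ) ^ (𝒬.rank - 1) - 1 < d ∧ Nonempty 𝒬.Point := by
  obtain ⟨M, hM⟩ := 𝒬.exists_model
  obtain ⟨G, hG, hGr⟩ := 𝒬.exists_finrank_eq_rank
  have hMG := (hM G).1 hG
  have hq : (1 : ℝ) < Nat.card F := by exact_mod_cast Finite.one_lt_card (α := F)
  have hq0 : (Nat.card F : ℝ) - 1 ≠ 0 := by linarith
  set q : ℝ := (Nat.card F : ℝ)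
  set c' : ℝ := (q ^ (𝒬.rank - 1) - 1) / (q - 1) with hc'
  have hc'0 : 0 < c' :=
    div_pos (sub_pos.2 (one_lt_pow₀ hq (by omega))) (sub_pos.2 hq)
  -- A generator has `q^(r-1) + c'` points, `c'` being the number in a hyperplane of it. So `A χ` is
  -- `θ + c'` on `G` and `c'` off it, i.e. `A χ = θ χ + c' 1` with `θ = q^(r-1) - 1`.
  have hc : (q ^ (𝒬.rank - 1) + c') * (q - 1) = q ^ 𝒬.rank - 1 := by
    rw [add_mul, hc', div_mul_cancel₀ _ hq0]
    have : q ^ 𝒬.rank = q ^ (𝒬.rank - 1) * q := by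
      rw [← pow_succ]
      congr 1
      omega
    rw [this]
    ring
  have hχ := 𝒬.adjacency_indicator_apply hG hGr hc (div_mul_cancel₀ _ hq0)
  obtain ⟨x, hxG, hx0⟩ : ∃ x ∈ G, x ≠ 0 := by
    refine (Submodule.ne_bot_iff G).1 fun h => ?_
    rw [h, finrank_bot] at hGr
    omega
  -- This gives a point outside `G`, the zero of `χ` that shows the eigenvector to be nonzero.
  obtain ⟨y, hyS, hxy⟩ := M.exists_singular_form_ne_zero (hMG x hxG).1 hx0
  have hyG : y ∉ G := fun h => hxy ((hMG x hxG).2 y h)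
  have hpt : ∀ z ∈ M.singular, z ≠ 0 → (F ∙ z) ∈ 𝒬.subspaces 1 := fun z hz hz0 =>
    ⟨(hM _).2 (PolarModel.Mem.span_singleton hz), finrank_span_singleton hz0⟩
  let P : 𝒬.Point := ⟨F ∙ x, hpt x (hMG x hxG).1 hx0⟩
  let P' : 𝒬.Point := ⟨F ∙ y, hpt y hyS fun h => hyG (h ▸ G.zero_mem)⟩
  have hP : P.1 ≤ G := (Submodule.span_singleton_le_iff_mem _ _).2 hxG
  have hP' : ¬ P'.1 ≤ G := fun h => hyG ((Submodule.span_singleton_le_iff_mem _ _).1 h)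
  refine ⟨hasEigenvalue_of_apply_eq 𝒬.adjacency (χ := fun P => if P.1 ≤ G then 1 else 0)
    (P := P') h1 (h := c') (funext fun Q => ?_) hc'0.ne' (if_neg hP'), ?_, ⟨P⟩⟩
  · rw [hχ Q]
    simp only [Pi.add_apply, Pi.smul_apply, Pi.one_apply, smul_eq_mul]
    split_ifs <;> ring
  -- At a point of `G` the degree is at least the number of its neighbours in `G`, which is `θ + c'
  -- > θ`.
  · have hle : 𝒬.adjacency (fun P => if P.1 ≤ G then 1 else 0) P ≤ 𝒬.adjacency 1 P := by
      rw [adjacency_apply, adjacency_apply]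
      refine Finset.sum_le_sum fun R _ => ?_
      simp only [Pi.one_apply]
      split_ifs <;> norm_num
    rw [hχ P, if_pos hP, h1] at hle
    simp only [Pi.smul_apply, Pi.one_apply, smul_eq_mul, mul_one] at hle
    linarith

end ClassicalPolarSpace

end

/-! ### Fisher's inequality by comparing dimensions. -/

theorem mainTheorem1 {F V : Type*} [Field F] [Finite F] [AddCommGroup V] [Module F V]
    [FiniteDimensional F V] (𝒬 : ClassicalPolarSpace F V) (t r k lam : ℕ)
    (D : Set (Submodule F V)) (hD : 𝒬.IsDesign t r k lam D) (ht : 2 ≤ t) (hlam : 1 ≤ lam) :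
    (k < r → (𝒬.subspaces 1).ncard ≤ D.ncard) ∧
    (k = r →
      𝒬.adjacency.HasEigenvalue ((Nat.card F : ℝ) ^ (r - 1) - 1) ∧
      1 + Module.finrank ℝ (𝒬.adjacency.eigenspace ((Nat.card F : ℝ) ^ (r - 1) - 1)) ≤
        D.ncard) := by
  have : Finite V := Module.finite_of_finite F
  have : Finite (Submodule F V) := Finite.of_injective _ SetLike.coe_injective
  have := Fintype.ofFinite D
  have hcard : D.ncard = Fintype.card D := by
    rw [← Nat.card_coe_set_eq, Nat.card_eq_fintype_card]
  rw [hcard]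
  refine ⟨fun hkr => ?_, fun _ => ?_⟩
  · have := LinearMap.finrank_le_finrank_of_injective (hD.injective_blockSum ht hlam hkr)
    rwa [Module.finrank_fintype_fun_eq_card, Module.finrank_fintype_fun_eq_card,
      ← Nat.card_eq_fintype_card, Nat.card_coe_set_eq] at this
  · have hr := hD.rank_eq
    have htr := hD.t_le
    obtain ⟨d, hd⟩ := hD.exists_adjacency_one ht hlam
    obtain ⟨M, hM⟩ := 𝒬.exists_model
    obtain ⟨-, l₁, hl₁, l₂, -, h₁, h₂, -⟩ :=
      ClassicalPolarSpace.exists_ncard_blocks_point_line M hM hD.subset ht (hr ▸ htr) hlam hD.ncard_eq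
    obtain ⟨he, hlt, hne⟩ := 𝒬.hasEigenvalue_and_lt_degree (by omega) hd
    rw [hr] at he hlt
    have hθ : 0 ≤ (Nat.card F : ℝ) ^ (r - 1) - 1 :=
      sub_nonneg.2 (one_le_pow₀ (by exact_mod_cast (Finite.one_lt_card (α := F)).le))
    exact ⟨he, ClassicalPolarSpace.one_add_finrank_eigenspace_le (fun B hB => (hD.subset hB).1)
      h₁ h₂ hl₁ hθ (hθ.trans hlt.le) hlt.ne' hd⟩
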